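/- Let $P$ be a finite nonempty set of participants and let $\Gamma$ be an access structure on $P$, i.e. an upward closed family of subsets of $P$ (the qualified sets). A perfect secret sharing scheme $\Sigma$ for $\Gamma$ consists of finite-valued random variables on a common probability space, one variable $S$ (the secret) and one for the share of each $x\in P$, such that, with $H$ the (joint) Shannon entropy and $H(S\mid X)=H(\{S\}\cup X)-H(X)$, one has $H(S)>0$, $H(S\mid X)=0$ for every qualified $X\subseteq P$, and $H(S\mid X)=H(S)$ for every unqualified $X\subseteq P$. Its information rate is $\rho(\Sigma)=\min_{x\in P} H(S)/H(x)$, and $\rho(\Gamma)$ is the supremum of $\rho(\Sigma)$ over all perfect secret sharing schemes $\Sigma$ for $\Gamma$. The Vamos matroid is the matroid on $\{v_1,\dots,v_8\}$ whose independent sets are all sets with fewer than five elements except $A\cup B$, $A\cup C$, $B\cup C$, $B\cup D$, $C\cup D$, where $A=\{v_1,v_2\}$, $B=\{v_3,v_4\}$, $C=\{v_5,v_6\}$, $D=\{v_7,v_8\}$. For $i\in\{1,6\}$ let $V_i$ be the access structure on the eight participants $\{v_1,\dots,v_8\}$ induced by this matroid with dealer $v_i$, the dealer being counted as a participant who is qualified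 on their own: a set is qualified if and only if it contains $v_i$ or contains a set $Y\not\ni v_i$ such that $Y\cup\{v_i\}$ is a circuit of the Vamos matroid. Then $$\rho(V_6)\le \frac{17}{19}\qquad\text{and}\qquad \rho(V_1)\le\frac{19}{21}.$$ -/

import Mathlib

open MeasureTheory
open scoped ENNReal

universe u

namespace SecretSharing

/-! ### Access structures and secret sharing schemes -/

/-- An access structure on a set `P` of participants: an upward closed family of (finite) sets of
participants, the qualified sets. -/
structure AccessStructure (P : Type*) where
  /-- The family of qualified sets. -/
  qualified : Set (Finset P)
  /-- A set of participants that contains a qualified set is qualified. -/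
  mono : ∀ ⦃X Y : Finset P⦄, X ∈ qualified → X ⊆ Y → Y ∈ qualified

/-- The Shannon entropy (in nats) `-∑ a, ℙ(f = a) log ℙ(f = a)` of a finite-valued random variable
`f` on `(Ω, μ)`. -/
noncomputable def shannonEntropy {Ω : Type*} [MeasurableSpace Ω] (μ : Measure Ω)
    {α : Type*} [Fintype α] (f : Ω → α) : ℝ :=
  ∑ a : α, Real.negMulLog (μ.real (f ⁻¹' {a}))

/-- A collection of finite-valued random variables on a common probability space, one for the
secret (index `none`) and one for the share of each participant `x : P` (index `some x`). -/
structure ShareFamily (P : Type*) where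
  /-- The sample space. -/
  Ω : Type u
  /-- The events. -/
  [measurableSpace : MeasurableSpace Ω]
  /-- The probability measure. -/
  μ : Measure Ω
  [isProbabilityMeasure : IsProbabilityMeasure μ]
  /-- The finite sets in which the random variables take their values. -/
  Val : Option P → Type u
  [fintype : ∀ i, Fintype (Val i)]
  /-- The random variables. -/
  rv : ∀ i, Ω → Val i
  measurable : ∀ (i : Option P) (a : Val i), MeasurableSet (rv i ⁻¹' {a})

attribute [instance] ShareFamily.measurableSpace ShareFamily.isProbabilityMeasure
  ShareFamily.fintype

namespace ShareFamily

variable {P : Type*} [DecidableEq P] (F : ShareFamily.{u} P)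

/-- The joint entropy `H(X)` of the random variables with index in `X ⊆ P ∪ {S}`. -/
noncomputable def H (X : Finset (Option P)) : ℝ :=
  shannonEntropy F.μ (fun ω (i : X) => F.rv i ω)

/-- The conditional entropy `H(X | Y) = H(X ∪ Y) - H(Y)`. -/
noncomputable def condH (X Y : Finset (Option P)) : ℝ :=
  F.H (X ∪ Y) - F.H Y

/-- `F` is a perfect secret sharing scheme for `Γ`: the secret has positive entropy, it is
determined by the shares of any qualified set, and its uncertainty is unaffected by the shares of
any unqualified set. -/
structure IsPerfectScheme (Γ : AccessStructure P) : Prop where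
  secret_pos : 0 < F.H {none}
  qualified : ∀ X : Finset P, X ∈ Γ.qualified → F.condH {none} (X.image some) = 0
  unqualified : ∀ X : Finset P, X ∉ Γ.qualified →
    F.condH {none} (X.image some) = F.H {none}

/-- The information rate `ρ(x) = H(S) / H(x)` of a participant `x`. -/
noncomputable def participantRate (x : P) : ℝ :=
  F.H {none} / F.H {some x}

/-- The information rate `ρ(Σ)` of a scheme: the minimum of the rates of the participants. -/
noncomputable def rate [Fintype P] [Nonempty P] : ℝ :=
  Finset.univ.inf' Finset.univ_nonempty F.participantRate

end ShareFamily

/-- The information rate `ρ(Γ)` of an access structure: the supremum of `ρ(Σ)` over all perfect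
secret sharing schemes `Σ` for `Γ`. It is taken in `[0, ∞]`, where every supremum exists (all the
rates `ρ(Σ)` are nonnegative). -/
noncomputable def informationRate {P : Type*} [DecidableEq P] [Fintype P] [Nonempty P]
    (Γ : AccessStructure P) : ℝ≥0∞ :=
  ⨆ (F : ShareFamily.{u} P) (_ : F.IsPerfectScheme Γ), ENNReal.ofReal F.rate

/-! ### Access structures induced by a matroid -/

/-- The access structure induced by a matroid `M` with dealer `d`, where the dealer is counted as a
participant that is qualified on its own. The qualified sets are those that contain `d`, or contain
a set `Y` with `d ∉ Y` such that `Y ∪ {d}` is a circuit of `M`. -/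
def inducedAccess {Q : Type*} [DecidableEq Q] (M : Matroid Q) (d : Q) : AccessStructure Q where
  qualified := {X | d ∈ X ∨
    ∃ Y : Finset Q, d ∉ Y ∧ M.IsCircuit ((insert d Y : Finset Q) : Set Q) ∧ Y ⊆ X}
  mono := by
    rintro X X' (h | ⟨Y, hd, hY, hYX⟩) hX
    · exact Or.inl (hX h)
    · exact Or.inr ⟨Y, hd, hY, hYX.trans hX⟩

/-! ### The Vamos matroid

The points `v_1, …, v_8` are `0, …, 7 : Fin 8`. -/

/-- The Vamos pair `A = {v_1, v_2}`. -/
def pairA : Finset (Fin 8) := {0, 1}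

/-- The Vamos pair `B = {v_3, v_4}`. -/
def pairB : Finset (Fin 8) := {2, 3}

/-- The Vamos pair `C = {v_5, v_6}`. -/
def pairC : Finset (Fin 8) := {4, 5}

/-- The Vamos pair `D = {v_7, v_8}`. -/
def pairD : Finset (Fin 8) := {6, 7}

/-- The five dependent sets of size four: `AB`, `AC`, `BC`, `BD`, `CD`. -/
def vamosPlanes : Finset (Finset (Fin 8)) :=
  {pairA ∪ pairB, pairA ∪ pairC, pairB ∪ pairC, pairB ∪ pairD, pairC ∪ pairD}

/-- A set is independent if it has fewer than five elements and is not one of `AB`, `AC`, `BC`,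
`BD`, `CD`. -/
def VamosIndep (I : Finset (Fin 8)) : Prop :=
  I.card < 5 ∧ I ∉ vamosPlanes

set_option maxRecDepth 100000 in
theorem card_of_mem_vamosPlanes : ∀ X ∈ vamosPlanes, X.card = 4 := by decide

set_option maxRecDepth 100000 in
theorem card_inter_of_mem_vamosPlanes :
    ∀ X ∈ vamosPlanes, ∀ Y ∈ vamosPlanes, X ≠ Y → (X ∩ Y).card ≤ 2 := by decide

theorem VamosIndep.subset ⦃I J : Finset (Fin 8)⦄ (hJ : VamosIndep J) (h : I ⊆ J) :
    VamosIndep I := by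
  refine ⟨(Finset.card_le_card h).trans_lt hJ.1, fun hI => ?_⟩
  have h4 := card_of_mem_vamosPlanes I hI
  have hlt := hJ.1
  have : I = J := Finset.eq_of_subset_of_card_le h (by omega)
  exact hJ.2 (this ▸ hI)

theorem VamosIndep.augment ⦃I J : Finset (Fin 8)⦄ (_hI : VamosIndep I) (hJ : VamosIndep J)
    (h : I.card < J.card) : ∃ e ∈ J, e ∉ I ∧ VamosIndep (insert e I) := by
  by_contra! hcon
  have hJ5 := hJ.1
  have key : ∀ e ∈ J, e ∉ I → insert e I ∈ vamosPlanes := by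
    intro e he heI
    by_contra hn
    refine hcon e he heI ⟨?_, hn⟩
    rw [Finset.card_insert_of_notMem heI]
    omega
  obtain ⟨e, he, heI⟩ := Finset.exists_mem_notMem_of_card_lt_card h
  have h3 : I.card = 3 := by
    have h4 := card_of_mem_vamosPlanes _ (key e he heI)
    rw [Finset.card_insert_of_notMem heI] at h4
    omega
  by_cases hsub : J ⊆ insert e I
  · have hJe : J = insert e I := Finset.eq_of_subset_of_card_le hsub (by
      rw [Finset.card_insert_of_notMem heI]
      omega)
    exact hJ.2 (hJe ▸ key e he heI)
  · obtain ⟨f, hf, hfe⟩ := Finset.not_subset.mp hsub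
    have hfI : f ∉ I := fun hfI => hfe (Finset.mem_insert_of_mem hfI)
    have hne : insert e I ≠ insert f I := fun heq =>
      hfe (heq ▸ Finset.mem_insert_self f I)
    have h2 := card_inter_of_mem_vamosPlanes _ (key e he heI) _ (key f hf hfI) hne
    have h3' : I.card ≤ (insert e I ∩ insert f I).card :=
      Finset.card_le_card (Finset.subset_inter (Finset.subset_insert e I)
        (Finset.subset_insert f I))
    omega

/-- The Vamos matroid. -/
def vamosMatroid : Matroid (Fin 8) :=
  (IndepMatroid.ofFinset Set.univ VamosIndep ⟨by decide, by decide⟩ VamosIndep.subset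
    VamosIndep.augment (fun _ _ => Set.subset_univ _)).matroid

/-- The access structure induced by the Vamos matroid with dealer `v_1`. -/
def V1 : AccessStructure (Fin 8) := inducedAccess vamosMatroid 0

/-- The access structure induced by the Vamos matroid with dealer `v_6`. -/
def V6 : AccessStructure (Fin 8) := inducedAccess vamosMatroid 5

end SecretSharing

/-! Both bounds follow from the stronger `ρ ≤ 8/9`, in the form `max_x H(x) ≥ 9/8 · H(S)`. A set
avoiding the dealer is qualified exactly when its matroid closure contains the dealer. Perfectness
therefore yields `H(X ∪ S) = H(X)` for sets spanning the dealer and `H(X ∪ S) = H(X) + H(S)` for the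
others. Shannon's inequalities alone cannot force a rate below 1, since the Vamos rank function
satisfies them together with these relations.

The extra ingredient is the copy lemma (`exists_isCopyExtension`): two copies of all the variables
are glued along a set `K` and made independent given `K`. For `V6`, `K = A ∪ B` and the pair `C` is
copied; for `V1`, `K = B ∪ C` and `A` is copied. The copied pair consists of the secret and its
partner, and each of the two pairs in `K` determines the copied secret together with the copied
partner. Submodularity for originals and copies jointly, the conditional independence and the
perfectness relations form a linear program; explicit dual solutions in `V6_share_bound` and
`V1_share_bound` give the constant 9/8. -/

namespace SecretSharing

/-! ### Entropy on a finite weighted space -/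

section Weighted

open scoped Classical

variable {Ω : Type*} [Fintype Ω] {α β γ δ : Type*}

/-- The weight of the fibre of `f` through `ω`. -/
noncomputable def fiberMass (p : Ω → ℝ) (f : Ω → α) (ω : Ω) : ℝ :=
  ∑ ω', if f ω' = f ω then p ω' else 0

/-- The entropy of `f` with respect to the weights `p`. -/
noncomputable def wEntropy (p : Ω → ℝ) (f : Ω → α) : ℝ :=
  -∑ ω, p ω * Real.log (fiberMass p f ω)

variable {p : Ω → ℝ}

theorem fiberMass_nonneg (hp : ∀ ω, 0 ≤ p ω) (f : Ω → α) (ω : Ω) : 0 ≤ fiberMass p f ω :=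
  Finset.sum_nonneg fun ω' _ => by split_ifs <;> simp [hp]

theorem le_fiberMass (hp : ∀ ω, 0 ≤ p ω) (f : Ω → α) (ω : Ω) : p ω ≤ fiberMass p f ω := by
  have := Finset.single_le_sum (f := fun ω' => if f ω' = f ω then p ω' else 0)
    (fun ω' _ => by split_ifs <;> simp [hp]) (Finset.mem_univ ω)
  simpa [fiberMass] using this

theorem fiberMass_pos (hp : ∀ ω, 0 ≤ p ω) (f : Ω → α) {ω : Ω} (h : p ω ≠ 0) :
    0 < fiberMass p f ω :=
  ((hp ω).lt_of_ne' h).trans_le (le_fiberMass hp f ω)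

theorem fiberMass_congr_point {f : Ω → α} {ω ω' : Ω} (h : f ω = f ω') :
    fiberMass p f ω = fiberMass p f ω' := by
  simp only [fiberMass, h]

theorem fiberMass_mono (hp : ∀ ω, 0 ≤ p ω) {f : Ω → α} {g : Ω → β}
    (h : ∀ ω ω', f ω = f ω' → g ω = g ω') (ω : Ω) : fiberMass p f ω ≤ fiberMass p g ω := by
  refine Finset.sum_le_sum fun ω' _ => ?_
  by_cases h1 : f ω' = f ω
  · simp [h1, h _ _ h1]
  · rw [if_neg h1]; split_ifs <;> simp [hp]

/-- Entropy depends only on the partition induced on the support. -/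
theorem wEntropy_congr {f : Ω → α} {g : Ω → β}
    (h : ∀ ω ω', p ω ≠ 0 → p ω' ≠ 0 → (f ω = f ω' ↔ g ω = g ω')) :
    wEntropy p f = wEntropy p g := by
  unfold wEntropy
  congr 1
  refine Finset.sum_congr rfl fun ω _ => ?_
  by_cases h0 : p ω = 0
  · simp [h0]
  · congr 2
    refine Finset.sum_congr rfl fun ω' _ => ?_
    by_cases h1 : p ω' = 0
    · simp [h1]
    · simp only [h ω' ω h1 h0]

theorem wEntropy_mono (hp : ∀ ω, 0 ≤ p ω) {f : Ω → α} {g : Ω → β}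
    (h : ∀ ω ω', f ω = f ω' → g ω = g ω') : wEntropy p g ≤ wEntropy p f := by
  unfold wEntropy
  refine neg_le_neg (Finset.sum_le_sum fun ω _ => ?_)
  by_cases h0 : p ω = 0
  · simp [h0]
  · exact mul_le_mul_of_nonneg_left
      (Real.log_le_log (fiberMass_pos hp f h0) (fiberMass_mono hp h ω)) (hp ω)

/-- The set `s` lies in one fibre of `k`, where the denominator is constant and equal to the mass of
the whole fibre. Equality can fail even for a full fibre, as a null fibre gives `0 / 0 = 0`. -/
theorem sum_div_fiberMass_le_one (hp : ∀ ω, 0 ≤ p ω) (k : Ω → γ) (s : Ω → Prop)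
    (hs : ∀ ω ω', s ω → s ω' → k ω = k ω') :
    ∑ ω, (if s ω then p ω / fiberMass p k ω else 0) ≤ 1 := by
  by_cases hex : ∃ ω₀, s ω₀
  · obtain ⟨ω₀, h0⟩ := hex
    calc ∑ ω, (if s ω then p ω / fiberMass p k ω else 0)
        ≤ ∑ ω, (if k ω = k ω₀ then p ω else 0) / fiberMass p k ω₀ := by
          refine Finset.sum_le_sum fun ω _ => ?_
          by_cases h : s ω
          · have := hs _ _ h h0
            simp [h, this, fiberMass_congr_point this]
          · rw [if_neg h]
            refine div_nonneg ?_ (fiberMass_nonneg hp _ _)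
            split_ifs <;> simp [hp]
      _ = fiberMass p k ω₀ / fiberMass p k ω₀ := by rw [← Finset.sum_div]; rfl
      _ ≤ 1 := div_self_le_one _
  · push Not at hex
    simp [hex]

/-- The Gibbs-type estimate behind submodularity. -/
theorem sum_mul_fiberMass_div_le (hp : ∀ ω, 0 ≤ p ω) {f : Ω → α} {g : Ω → β} {k : Ω → γ}
    {c : Ω → δ} (hk : ∀ ω ω', f ω = f ω' → g ω = g ω' → k ω = k ω')
    (hf : ∀ ω ω', f ω = f ω' → c ω = c ω') (hg : ∀ ω ω', g ω = g ω' → c ω = c ω') :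
    ∑ ω, p ω * (fiberMass p f ω * fiberMass p g ω / (fiberMass p k ω * fiberMass p c ω)) ≤
      ∑ ω, p ω := by
  -- Opening both fibre masses allows summation over `ω` first: for fixed `ω₁, ω₂` the contributing
  -- `ω` share one value of `k`, so `sum_div_fiberMass_le_one` applies.
  have expand : ∀ ω, p ω * (fiberMass p f ω * fiberMass p g ω /
      (fiberMass p k ω * fiberMass p c ω)) =
      ∑ ω₁, ∑ ω₂, (if f ω₁ = f ω then p ω₁ else 0) * (if g ω₂ = g ω then p ω₂ else 0) *
        (p ω / (fiberMass p k ω * fiberMass p c ω)) := by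
    intro ω
    simp_rw [← Finset.sum_mul, ← Finset.mul_sum, ← Finset.sum_mul]
    change _ = fiberMass p f ω * fiberMass p g ω * _
    ring
  simp_rw [expand]
  rw [Finset.sum_comm]
  refine Finset.sum_le_sum fun ω₁ _ => ?_
  rw [Finset.sum_comm]
  calc _ ≤ ∑ ω₂, p ω₁ * ((if c ω₂ = c ω₁ then p ω₂ else 0) / fiberMass p c ω₁) := by
        refine Finset.sum_le_sum fun ω₂ _ => ?_
        by_cases hc : c ω₂ = c ω₁
        · have h1 := sum_div_fiberMass_le_one hp k (fun ω => f ω₁ = f ω ∧ g ω₂ = g ω)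
            (fun ω ω' h h' => hk _ _ (h.1.symm.trans h'.1) (h.2.symm.trans h'.2))
          have h2 : 0 ≤ p ω₁ * (p ω₂ / fiberMass p c ω₁) :=
            mul_nonneg (hp _) (div_nonneg (hp _) (fiberMass_nonneg hp _ _))
          rw [if_pos hc]
          refine le_trans (le_of_eq ?_) (mul_le_of_le_one_right h2 h1)
          rw [Finset.mul_sum]
          refine Finset.sum_congr rfl fun ω _ => ?_
          by_cases h3 : f ω₁ = f ω
          · by_cases h4 : g ω₂ = g ω
            · rw [if_pos h3, if_pos h4, if_pos ⟨h3, h4⟩, fiberMass_congr_point (hf _ _ h3)]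
              simp only [div_eq_mul_inv, mul_inv]
              ring
            · simp [h4]
          · simp [h3]
        · rw [if_neg hc]
          refine le_of_eq ?_
          rw [zero_div, mul_zero]
          refine Finset.sum_eq_zero fun ω _ => ?_
          by_cases h3 : f ω₁ = f ω
          · by_cases h4 : g ω₂ = g ω
            · exact absurd ((hg _ _ h4).trans (hf _ _ h3).symm) hc
            · simp [h4]
          · simp [h3]
    _ = p ω₁ * (fiberMass p c ω₁ / fiberMass p c ω₁) := by
        rw [← Finset.mul_sum, ← Finset.sum_div]; rfl
    _ ≤ p ω₁ := mul_le_of_le_one_right (hp _) (div_self_le_one _)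

/-- Average `log t ≤ t - 1` over `p`, with `t` the ratio of fibre masses in
`sum_mul_fiberMass_div_le`; that estimate makes the right-hand side nonpositive. -/
theorem wEntropy_submod (hp : ∀ ω, 0 ≤ p ω) {f : Ω → α} {g : Ω → β} {k : Ω → γ}
    {c : Ω → δ} (hk : ∀ ω ω', f ω = f ω' → g ω = g ω' → k ω = k ω')
    (hf : ∀ ω ω', f ω = f ω' → c ω = c ω') (hg : ∀ ω ω', g ω = g ω' → c ω = c ω') :
    wEntropy p k + wEntropy p c ≤ wEntropy p f + wEntropy p g := by
  have key : ∑ ω, p ω * (1 - fiberMass p f ω * fiberMass p g ω /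
      (fiberMass p k ω * fiberMass p c ω)) ≤
      ∑ ω, p ω * (Real.log (fiberMass p k ω) + Real.log (fiberMass p c ω)
        - Real.log (fiberMass p f ω) - Real.log (fiberMass p g ω)) := by
    refine Finset.sum_le_sum fun ω _ => ?_
    by_cases h0 : p ω = 0
    · simp [h0]
    refine mul_le_mul_of_nonneg_left ?_ (hp ω)
    have h1 := fiberMass_pos hp f h0
    have h2 := fiberMass_pos hp g h0
    have h3 := fiberMass_pos hp k h0
    have h4 := fiberMass_pos hp c h0
    have h5 := Real.log_le_sub_one_of_pos (div_pos (mul_pos h1 h2) (mul_pos h3 h4))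
    rw [Real.log_div (by positivity) (by positivity), Real.log_mul h1.ne' h2.ne',
      Real.log_mul h3.ne' h4.ne'] at h5
    linarith
  have h6 := sum_mul_fiberMass_div_le hp hk hf hg
  simp only [mul_sub, mul_add, mul_one, Finset.sum_sub_distrib, Finset.sum_add_distrib] at key
  unfold wEntropy
  linarith

/-- The weights on `Ω × Ω` making the two coordinates copies of `(Ω, p)` that are independent
conditionally on the common value of `k`. -/
noncomputable def copyWeight (p : Ω → ℝ) (k : Ω → γ) (x : Ω × Ω) : ℝ :=
  if k x.1 = k x.2 then p x.1 * p x.2 / fiberMass p k x.1 else 0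

theorem copyWeight_nonneg (hp : ∀ ω, 0 ≤ p ω) (k : Ω → γ) (x : Ω × Ω) :
    0 ≤ copyWeight p k x := by
  unfold copyWeight
  split_ifs
  · exact div_nonneg (mul_nonneg (hp _) (hp _)) (fiberMass_nonneg hp _ _)
  · exact le_rfl

theorem copyWeight_swap (k : Ω → γ) (x : Ω × Ω) :
    copyWeight p k x.swap = copyWeight p k x := by
  unfold copyWeight
  by_cases h : k x.1 = k x.2
  · simp [h, fiberMass_congr_point h, mul_comm]
  · simp [h, Ne.symm h]

theorem eq_of_copyWeight_ne_zero {k : Ω → γ} {x : Ω × Ω} (h : copyWeight p k x ≠ 0) :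
    k x.1 = k x.2 := by
  by_contra hn
  exact h (if_neg hn)

theorem ne_zero_of_copyWeight_ne_zero {k : Ω → γ} {x : Ω × Ω} (h : copyWeight p k x ≠ 0) :
    p x.1 ≠ 0 ∧ p x.2 ≠ 0 := by
  refine ⟨fun h0 => h ?_, fun h0 => h ?_⟩ <;> simp [copyWeight, h0]

/-- The second point ranges over the `k`-fibre of `ω`, whose mass cancels the normalisation. Hence
each coordinate separately has the law `p`. -/
theorem sum_copyWeight_right (hp : ∀ ω, 0 ≤ p ω) (k : Ω → γ) (ω : Ω) :
    ∑ ω', copyWeight p k (ω, ω') = p ω := by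
  have : ∀ ω', copyWeight p k (ω, ω') =
      p ω / fiberMass p k ω * (if k ω' = k ω then p ω' else 0) := by
    intro ω'
    by_cases h : k ω = k ω'
    · simp only [copyWeight, h, if_true]; ring
    · simp [copyWeight, h, Ne.symm h]
  simp_rw [this, ← Finset.mul_sum]
  change p ω / fiberMass p k ω * fiberMass p k ω = p ω
  by_cases h0 : p ω = 0
  · simp [h0]
  · exact div_mul_cancel₀ _ (fiberMass_pos hp k h0).ne'

theorem sum_copyWeight_left (hp : ∀ ω, 0 ≤ p ω) (k : Ω → γ) (ω : Ω) :
    ∑ ω', copyWeight p k (ω', ω) = p ω := by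
  rw [← sum_copyWeight_right hp k ω]
  exact Finset.sum_congr rfl fun ω' _ => (copyWeight_swap k (ω', ω)).symm

theorem sum_copyWeight_mul_fst (hp : ∀ ω, 0 ≤ p ω) (k : Ω → γ) (u : Ω → ℝ) :
    ∑ x, copyWeight p k x * u x.1 = ∑ ω, p ω * u ω := by
  rw [Fintype.sum_prod_type]
  refine Finset.sum_congr rfl fun ω _ => ?_
  dsimp only
  rw [← Finset.sum_mul, sum_copyWeight_right hp]

theorem sum_copyWeight_mul_snd (hp : ∀ ω, 0 ≤ p ω) (k : Ω → γ) (u : Ω → ℝ) :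
    ∑ x, copyWeight p k x * u x.2 = ∑ ω, p ω * u ω := by
  rw [Fintype.sum_prod_type_right]
  refine Finset.sum_congr rfl fun ω _ => ?_
  dsimp only
  rw [← Finset.sum_mul, sum_copyWeight_left hp]

theorem wEntropy_copy_fst (hp : ∀ ω, 0 ≤ p ω) (k : Ω → γ) (f : Ω → α) :
    wEntropy (copyWeight p k) (fun x => f x.1) = wEntropy p f := by
  have : ∀ x : Ω × Ω, fiberMass (copyWeight p k) (fun x => f x.1) x = fiberMass p f x.1 := by
    intro x
    have := sum_copyWeight_mul_fst hp k (fun ω => if f ω = f x.1 then 1 else 0)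
    simpa [fiberMass] using this
  unfold wEntropy
  simp_rw [this]
  rw [sum_copyWeight_mul_fst hp k fun ω => Real.log (fiberMass p f ω)]

theorem wEntropy_copy_snd (hp : ∀ ω, 0 ≤ p ω) (k : Ω → γ) (f : Ω → α) :
    wEntropy (copyWeight p k) (fun x => f x.2) = wEntropy p f := by
  have : ∀ x : Ω × Ω, fiberMass (copyWeight p k) (fun x => f x.2) x = fiberMass p f x.2 := by
    intro x
    have := sum_copyWeight_mul_snd hp k (fun ω => if f ω = f x.2 then 1 else 0)
    simpa [fiberMass] using this
  unfold wEntropy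
  simp_rw [this]
  rw [sum_copyWeight_mul_snd hp k fun ω => Real.log (fiberMass p f ω)]

/-- As `f` and `g` both refine `k`, the constraint `k x.1 = k x.2` holds on the whole product of the
two fibres, so the double sum factors. -/
theorem fiberMass_copy_prod {k : Ω → γ} {f : Ω → α} {g : Ω → β}
    (hf : ∀ ω ω', f ω = f ω' → k ω = k ω') (hg : ∀ ω ω', g ω = g ω' → k ω = k ω')
    {x : Ω × Ω} (hx : k x.1 = k x.2) :
    fiberMass (copyWeight p k) (fun x => (f x.1, g x.2)) x =
      fiberMass p f x.1 * fiberMass p g x.2 / fiberMass p k x.1 := by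
  rw [fiberMass, Fintype.sum_prod_type, fiberMass, fiberMass, Finset.sum_mul_sum,
    Finset.sum_div]
  refine Finset.sum_congr rfl fun ω _ => ?_
  rw [Finset.sum_div]
  refine Finset.sum_congr rfl fun ω' _ => ?_
  by_cases h1 : f ω = f x.1
  · by_cases h2 : g ω' = g x.2
    · have h3 : k ω = k ω' := (hf _ _ h1).trans (hx.trans (hg _ _ h2).symm)
      simp only [h1, h2, copyWeight, h3, if_true, ← fiberMass_congr_point (hf _ _ h1)]
    · simp [h2]
  · simp [h1]

/-- Conditional independence of the two copies. -/
theorem wEntropy_copy_prod (hp : ∀ ω, 0 ≤ p ω) {k : Ω → γ} {f : Ω → α} {g : Ω → β}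
    (hf : ∀ ω ω', f ω = f ω' → k ω = k ω') (hg : ∀ ω ω', g ω = g ω' → k ω = k ω') :
    wEntropy (copyWeight p k) (fun x => (f x.1, g x.2)) =
      wEntropy p f + wEntropy p g - wEntropy p k := by
  have : ∀ x : Ω × Ω, copyWeight p k x *
      Real.log (fiberMass (copyWeight p k) (fun x => (f x.1, g x.2)) x) =
      copyWeight p k x * Real.log (fiberMass p f x.1) +
        copyWeight p k x * Real.log (fiberMass p g x.2) -
        copyWeight p k x * Real.log (fiberMass p k x.1) := by
    intro x
    by_cases h0 : copyWeight p k x = 0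
    · simp [h0]
    obtain ⟨h1, h2⟩ := ne_zero_of_copyWeight_ne_zero h0
    have h3 := fiberMass_pos hp f h1
    have h4 := fiberMass_pos hp g h2
    have h5 := fiberMass_pos hp k h1
    rw [fiberMass_copy_prod hf hg (eq_of_copyWeight_ne_zero h0),
      Real.log_div (by positivity) h5.ne', Real.log_mul h3.ne' h4.ne']
    ring
  unfold wEntropy
  simp_rw [this, Finset.sum_sub_distrib, Finset.sum_add_distrib]
  rw [sum_copyWeight_mul_fst hp k fun ω => Real.log (fiberMass p f ω),
    sum_copyWeight_mul_snd hp k fun ω => Real.log (fiberMass p g ω),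
    sum_copyWeight_mul_fst hp k fun ω => Real.log (fiberMass p k ω)]
  ring

/-- Grouping points by the value of `f` links the pointwise form of entropy to the form in
`shannonEntropy`. -/
theorem wEntropy_eq_sum_negMulLog [Fintype α] (f : Ω → α) :
    wEntropy p f = ∑ a, Real.negMulLog (∑ ω, if f ω = a then p ω else 0) := by
  have : ∀ a, Real.negMulLog (∑ ω, if f ω = a then p ω else 0) =
      ∑ ω, if f ω = a then -(p ω * Real.log (fiberMass p f ω)) else 0 := by
    intro a
    rw [Real.negMulLog, neg_mul, Finset.sum_mul, ← Finset.sum_neg_distrib]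
    refine Finset.sum_congr rfl fun ω _ => ?_
    by_cases h : f ω = a
    · subst h; simp [fiberMass]
    · simp [h]
  simp_rw [this]
  rw [Finset.sum_comm]
  simp [wEntropy]

end Weighted

/-! ### Joint entropies of a family of variables and the copy lemma -/

/-- The joint entropy of the variables with index in `s`. -/
noncomputable def famEntropy {Ω ι : Type*} [Fintype Ω] {V : ι → Type*} (p : Ω → ℝ)
    (X : ∀ i, Ω → V i) (s : Finset ι) : ℝ :=
  wEntropy p (fun ω (i : s) => X i ω)

theorem restrict_eq_iff {Ω ι : Type*} {V : ι → Type*} {X : ∀ i, Ω → V i} {s : Finset ι}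
    {ω ω' : Ω} :
    (fun i : s => X i ω) = (fun i : s => X i ω') ↔ ∀ i ∈ s, X i ω = X i ω' := by
  simp [funext_iff]

section Family

variable {Ω ι : Type*} [Fintype Ω] {V : ι → Type*} {p : Ω → ℝ} {X : ∀ i, Ω → V i}

theorem famEntropy_mono (hp : ∀ ω, 0 ≤ p ω) {s t : Finset ι} (h : s ⊆ t) :
    famEntropy p X s ≤ famEntropy p X t :=
  wEntropy_mono hp fun ω ω' => by
    simp only [restrict_eq_iff]
    exact fun H i hi => H i (h hi)

theorem famEntropy_submod [DecidableEq ι] (hp : ∀ ω, 0 ≤ p ω) (s t : Finset ι) :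
    famEntropy p X (s ∪ t) + famEntropy p X (s ∩ t) ≤ famEntropy p X s + famEntropy p X t := by
  refine wEntropy_submod hp ?_ ?_ ?_ <;> intro ω ω' <;>
    simp only [restrict_eq_iff, Finset.mem_union, Finset.mem_inter]
  · rintro h1 h2 i (hi | hi)
    exacts [h1 i hi, h2 i hi]
  · exact fun h i hi => h i hi.1
  · exact fun h i hi => h i hi.2

end Family

/-- `h` is the joint entropy function of two copies of a family with joint entropy function `H`
that share the variables in `K` and are independent conditionally on them. -/
structure IsCopyExtension {ι : Type*} [DecidableEq ι] (H : Finset ι → ℝ) (K : Finset ι)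
    (h : Finset (ι ⊕ ι) → ℝ) : Prop where
  mono : ∀ s t, s ⊆ t → h s ≤ h t
  submod : ∀ s t, h (s ∪ t) + h (s ∩ t) ≤ h s + h t
  left : ∀ A, h (A.image Sum.inl) = H A
  transfer : ∀ A B, A ⊆ K → h (A.image Sum.inl ∪ B.image Sum.inr) = H (A ∪ B)
  indep : ∀ A B, K ⊆ A → h (A.image Sum.inl ∪ B.image Sum.inr) + H K = H A + H (K ∪ B)

/-- The model is `Ω × Ω` with `copyWeight`. On its support the two coordinates agree on `K`, and
entropy only sees the support (`wEntropy_congr`), so variables in `K` may be read from either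
coordinate. -/
theorem exists_isCopyExtension {Ω ι : Type*} [Fintype Ω] [DecidableEq ι] {V : ι → Type*}
    {p : Ω → ℝ} (hp : ∀ ω, 0 ≤ p ω) (X : ∀ i, Ω → V i) (K : Finset ι) :
    ∃ h, IsCopyExtension (famEntropy p X) K h := by
  classical
  set q := copyWeight p (fun ω (i : K) => X i ω) with hq
  have hq0 : ∀ x, 0 ≤ q x := copyWeight_nonneg hp _
  let W : ι ⊕ ι → Type _ := Sum.elim V V
  let Y : ∀ j : ι ⊕ ι, Ω × Ω → W j := fun j => match j with
    | .inl i => fun x => X i x.1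
    | .inr i => fun x => X i x.2
  have hsupp : ∀ x, q x ≠ 0 → ∀ i ∈ K, X i x.1 = X i x.2 := fun x hx =>
    restrict_eq_iff.1 (eq_of_copyWeight_ne_zero hx)
  have hY : ∀ (A B : Finset ι) (x y : Ω × Ω),
      (∀ j ∈ A.image Sum.inl ∪ B.image Sum.inr, Y j x = Y j y) ↔
        (∀ i ∈ A, X i x.1 = X i y.1) ∧ ∀ i ∈ B, X i x.2 = X i y.2 := by
    intro A B x y
    simp only [Finset.mem_union, Finset.mem_image]
    constructor
    · intro h
      exact ⟨fun i hi => h (.inl i) (Or.inl ⟨i, hi, rfl⟩),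
        fun i hi => h (.inr i) (Or.inr ⟨i, hi, rfl⟩)⟩
    · rintro ⟨h1, h2⟩ j (⟨i, hi, rfl⟩ | ⟨i, hi, rfl⟩)
      exacts [h1 i hi, h2 i hi]
  refine ⟨famEntropy q Y, fun s t h => famEntropy_mono hq0 h, famEntropy_submod hq0, ?_, ?_, ?_⟩
  · intro A
    unfold famEntropy
    rw [← wEntropy_copy_fst hp (fun ω (i : K) => X i ω)]
    refine wEntropy_congr fun x y _ _ => ?_
    have := hY A ∅ x y
    simp only [Finset.image_empty, Finset.union_empty, Finset.notMem_empty, false_imp_iff,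
      implies_true, and_true] at this
    rw [restrict_eq_iff, this, restrict_eq_iff (X := X)]
  · intro A B hA
    unfold famEntropy
    rw [← wEntropy_copy_snd hp (fun ω (i : K) => X i ω)]
    refine wEntropy_congr fun x y hx hy => ?_
    rw [restrict_eq_iff, hY, restrict_eq_iff (X := X)]
    simp only [Finset.mem_union]
    constructor
    · rintro ⟨h1, h2⟩ i (hi | hi)
      · rw [← hsupp x hx i (hA hi), ← hsupp y hy i (hA hi), h1 i hi]
      · exact h2 i hi
    · intro h
      refine ⟨fun i hi => ?_, fun i hi => h i (Or.inr hi)⟩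
      rw [hsupp x hx i (hA hi), hsupp y hy i (hA hi), h i (Or.inl hi)]
  · intro A B hA
    -- The second factor must determine the conditioning variables, so `K` is adjoined to `B`. Since
    -- `K ⊆ A`, this does not change the joint entropy.
    have h1 := wEntropy_copy_prod hp (k := fun ω (i : K) => X i ω)
      (f := fun ω (i : A) => X i ω) (g := fun ω (i : (K ∪ B : Finset ι)) => X i ω)
      (fun ω ω' => by
        simp only [restrict_eq_iff]
        exact fun H i hi => H i (hA hi))
      (fun ω ω' => by
        simp only [restrict_eq_iff]
        exact fun H i hi => H i (Finset.mem_union_left _ hi))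
    have h2 : famEntropy q Y (A.image Sum.inl ∪ B.image Sum.inr) =
        wEntropy q (fun x => ((fun i : A => X i x.1),
          fun i : (K ∪ B : Finset ι) => X i x.2)) := by
      refine wEntropy_congr fun x y hx hy => ?_
      rw [restrict_eq_iff, hY, Prod.mk.injEq, restrict_eq_iff (X := X),
        restrict_eq_iff (X := X)]
      refine and_congr_right fun h => ?_
      constructor
      · intro h' i hi
        rcases Finset.mem_union.1 hi with hi | hi
        · rw [← hsupp x hx i hi, ← hsupp y hy i hi, h i (hA hi)]
        · exact h' i hi
      · exact fun h' i hi => h' i (Finset.mem_union_right _ hi)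
    unfold famEntropy at h2 ⊢
    rw [h2, h1]
    ring

/-! ### Reduction of a scheme to its finite joint distribution -/

namespace ShareFamily

variable {P : Type*} (F : ShareFamily.{u} P)

/-- The weights of the joint distribution of all the variables. -/
noncomputable def jointWeight (a : ∀ i, F.Val i) : ℝ :=
  F.μ.real {ω | ∀ i, F.rv i ω = a i}

/-- Every event fixing some of the variables is a finite disjoint union of events fixing all of
them, so the arbitrary sample space can be replaced by the finite space of value tuples. -/
theorem H_eq_famEntropy [DecidableEq P] [Fintype P] [Fintype (∀ i, F.Val i)] :
    F.H = famEntropy F.jointWeight (fun i (a : ∀ i, F.Val i) => a i) := by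
  classical
  funext s
  have hmeas : ∀ a : ∀ i, F.Val i, MeasurableSet {ω | ∀ i, F.rv i ω = a i} := by
    intro a
    rw [Set.ofPred_forall]
    exact MeasurableSet.iInter fun i => F.measurable i (a i)
  unfold H shannonEntropy famEntropy
  rw [wEntropy_eq_sum_negMulLog]
  refine Fintype.sum_congr _ _ fun b => ?_
  congr 1
  have : (fun ω (i : s) => F.rv i ω) ⁻¹' {b} =
      ⋃ a ∈ Finset.univ.filter (fun a : ∀ i, F.Val i => (fun i : s => a i) = b),
        {ω | ∀ i, F.rv i ω = a i} := by
    ext ω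
    simp only [Set.mem_preimage, Set.mem_singleton_iff, Set.mem_iUnion, Finset.mem_filter,
      Finset.mem_univ, true_and, Set.mem_ofPred_eq, exists_prop]
    constructor
    · exact fun h => ⟨fun i => F.rv i ω, h, fun _ => rfl⟩
    · rintro ⟨a, h, h'⟩
      rw [← h]
      funext i
      exact h' i
  rw [this, measureReal_biUnion_finset]
  · rw [Finset.sum_filter]
    refine Finset.sum_congr rfl fun a _ => ?_
    congr
  · intro a _ a' _ hne
    refine Set.disjoint_left.2 fun ω h h' => hne ?_
    funext i
    exact (h i).symm.trans (h' i)
  · exact fun a _ => hmeas a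

/-- The copy lemma for secret sharing schemes. -/
theorem exists_isCopyExtension_H [DecidableEq P] [Fintype P] (K : Finset (Option P)) :
    ∃ h, IsCopyExtension F.H K h := by
  classical
  rw [H_eq_famEntropy]
  exact exists_isCopyExtension (fun a => measureReal_nonneg) _ K

end ShareFamily

/-! ### Qualified sets of the Vamos access structures -/

instance (I : Finset (Fin 8)) : Decidable (VamosIndep I) := by
  unfold VamosIndep; infer_instance

theorem vamosMatroid_indep_coe (I : Finset (Fin 8)) :
    vamosMatroid.Indep (I : Set (Fin 8)) ↔ VamosIndep I :=
  IndepMatroid.ofFinset_indep Set.univ VamosIndep ⟨by decide, by decide⟩ VamosIndep.subset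
    VamosIndep.augment (fun _ _ => Set.subset_univ _)

theorem vamosMatroid_ground : vamosMatroid.E = Set.univ := rfl

/-- The circuit form matches the circuit description of the closure, turning qualification into `d ∈
M.closure X`. -/
theorem mem_qualified_inducedAccess_iff {Q : Type*} [DecidableEq Q] [Finite Q] {M : Matroid Q}
    {d : Q} {X : Finset Q} (hd : d ∉ X) :
    X ∈ (inducedAccess M d).qualified ↔ ∃ C ⊆ insert d (X : Set Q), M.IsCircuit C ∧ d ∈ C := by
  constructor
  · rintro (h | ⟨Y, -, hC, hYX⟩)
    · exact absurd h hd
    · refine ⟨_, ?_, hC, by simp⟩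
      rw [Finset.coe_insert]
      exact Set.insert_subset_insert (by exact_mod_cast hYX)
  · rintro ⟨C, hCX, hC, hdC⟩
    refine Or.inr ⟨(C.toFinite.toFinset).erase d, by simp, ?_, ?_⟩
    · rw [Finset.insert_erase (by simpa using hdC)]
      simpa using hC
    · intro x hx
      simp only [Finset.mem_erase, Set.Finite.mem_toFinset] at hx
      rcases hCX hx.2 with h | h
      exacts [absurd h hx.1, by exact_mod_cast h]

theorem mem_qualified_vamos {d : Fin 8} {X : Finset (Fin 8)} (I : Finset (Fin 8))
    (hd : d ∉ X) (hIX : I ⊆ X) (hI : VamosIndep I) (hdI : ¬ VamosIndep (insert d I)) :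
    X ∈ (inducedAccess vamosMatroid d).qualified := by
  rw [mem_qualified_inducedAccess_iff hd]
  rw [← vamosMatroid_indep_coe] at hI hdI
  rw [Finset.coe_insert] at hdI
  have hcl : d ∈ vamosMatroid.closure (I : Set (Fin 8)) := by
    rw [hI.mem_closure_iff]
    exact Or.inl ⟨hdI, by simp [vamosMatroid_ground]⟩
  obtain ⟨C, hC, hCc, hdC⟩ := (Matroid.mem_closure_iff_exists_isCircuit
    (fun h => hd (hIX (by exact_mod_cast h)))).1 hcl
  exact ⟨C, hC.trans (Set.insert_subset_insert (by exact_mod_cast hIX)), hCc, hdC⟩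

/-- Here `I` is a basis of `X`, so both have the same closure, and `d` is outside it. The hypotheses
are decidable, hence serve as a certificate. -/
theorem notMem_qualified_vamos {d : Fin 8} {X : Finset (Fin 8)} (I : Finset (Fin 8))
    (hd : d ∉ X) (hIX : I ⊆ X) (hdI : VamosIndep (insert d I))
    (hX : ∀ x ∈ X, x ∈ I ∨ ¬ VamosIndep (insert x I)) :
    X ∉ (inducedAccess vamosMatroid d).qualified := by
  have hI : VamosIndep I := hdI.subset (Finset.subset_insert d I)
  rw [mem_qualified_inducedAccess_iff hd, ← Matroid.mem_closure_iff_exists_isCircuit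
    (by exact_mod_cast hd)]
  rw [← vamosMatroid_indep_coe] at hI hdI
  have hcl : vamosMatroid.closure (X : Set (Fin 8)) ⊆ vamosMatroid.closure (I : Set (Fin 8)) := by
    refine vamosMatroid.closure_subset_closure_of_subset_closure fun x hx => ?_
    rw [hI.mem_closure_iff]
    rcases hX x (by exact_mod_cast hx) with h | h
    · exact Or.inr (by exact_mod_cast h)
    · refine Or.inl ⟨?_, by simp [vamosMatroid_ground]⟩
      rwa [← Finset.coe_insert, vamosMatroid_indep_coe]
  intro h
  rcases hI.mem_closure_iff.1 (hcl h) with h | h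
  · exact h.1 (by rwa [Finset.coe_insert] at hdI)
  · exact hd (hIX (by exact_mod_cast h))

/-! ### Bit masks

The entropies of subsets of the shares, the secret and two copied variables are indexed by bit
masks: bit `i < 8` stands for the share of `i` (for the secret if `i` is the dealer `d`), and bits
`8` and `9` stand for the copies of the variables `c 0` and `c 1`. -/

/-- The original variables in a mask. -/
def basePart (d : Fin 8) (m : ℕ) : Finset (Option (Fin 8)) :=
  (Finset.univ.filter fun i : Fin 8 => m.testBit i).image fun i => if i = d then none else some i

/-- The variables whose copies are in a mask. -/
def copyPart (c : Fin 2 → Option (Fin 8)) (m : ℕ) : Finset (Option (Fin 8)) :=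
  (Finset.univ.filter fun j : Fin 2 => m.testBit (8 + j)).image c

theorem basePart_lor (d : Fin 8) (x y : ℕ) :
    basePart d (x ||| y) = basePart d x ∪ basePart d y := by
  simp [basePart, Finset.filter_or, Finset.image_union]

theorem copyPart_lor (c : Fin 2 → Option (Fin 8)) (x y : ℕ) :
    copyPart c (x ||| y) = copyPart c x ∪ copyPart c y := by
  simp [copyPart, Finset.filter_or, Finset.image_union]

/-- The entropy of the variables in a mask. -/
def maskEntropy (h : Finset (Option (Fin 8) ⊕ Option (Fin 8)) → ℝ) (d : Fin 8)
    (c : Fin 2 → Option (Fin 8)) (m : ℕ) : ℝ :=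
  h ((basePart d m).image Sum.inl ∪ (copyPart c m).image Sum.inr)

/-! ### Shannon and copy rules for masks -/

section Mask

variable {H : Finset (Option (Fin 8)) → ℝ} {K : Finset (Option (Fin 8))}
  {h : Finset (Option (Fin 8) ⊕ Option (Fin 8)) → ℝ} {d : Fin 8} {c : Fin 2 → Option (Fin 8)}

theorem maskSet_lor (d : Fin 8) (c : Fin 2 → Option (Fin 8)) (x y : ℕ) :
    ((basePart d (x ||| y)).image Sum.inl ∪ (copyPart c (x ||| y)).image Sum.inr :
      Finset (Option (Fin 8) ⊕ Option (Fin 8))) =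
      ((basePart d x).image Sum.inl ∪ (copyPart c x).image Sum.inr) ∪
        ((basePart d y).image Sum.inl ∪ (copyPart c y).image Sum.inr) := by
  rw [basePart_lor, copyPart_lor, Finset.image_union, Finset.image_union]
  exact Finset.union_union_union_comm _ _ _ _

theorem IsCopyExtension.mask_mono (hh : IsCopyExtension H K h) (x y : ℕ) :
    maskEntropy h d c x ≤ maskEntropy h d c (x ||| y) := by
  unfold maskEntropy
  rw [maskSet_lor]
  exact hh.mono _ _ Finset.subset_union_left

theorem IsCopyExtension.mask_submod (hh : IsCopyExtension H K h) (x y z : ℕ) :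
    maskEntropy h d c (x ||| y ||| z) + maskEntropy h d c z ≤
      maskEntropy h d c (x ||| z) + maskEntropy h d c (y ||| z) := by
  unfold maskEntropy
  simp only [maskSet_lor]
  generalize ((basePart d x).image Sum.inl ∪ (copyPart c x).image Sum.inr :
      Finset (Option (Fin 8) ⊕ Option (Fin 8))) = X
  generalize ((basePart d y).image Sum.inl ∪ (copyPart c y).image Sum.inr :
      Finset (Option (Fin 8) ⊕ Option (Fin 8))) = Y
  generalize ((basePart d z).image Sum.inl ∪ (copyPart c z).image Sum.inr :
      Finset (Option (Fin 8) ⊕ Option (Fin 8))) = Z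
  have h1 := hh.submod (X ∪ Z) (Y ∪ Z)
  -- `X` and `Y` may overlap outside `Z`; monotonicity absorbs the excess.
  have h2 := hh.mono Z ((X ∪ Z) ∩ (Y ∪ Z))
    (Finset.subset_inter Finset.subset_union_right Finset.subset_union_right)
  rw [← Finset.union_union_distrib_right] at h1
  linarith

/-- Variables determined by those in `x` do not contribute to the entropy of larger sets. -/
theorem IsCopyExtension.mask_determined (hh : IsCopyExtension H K h) {x v : ℕ}
    (hxv : maskEntropy h d c (x ||| v) = maskEntropy h d c x) (y : ℕ) :
    maskEntropy h d c (y ||| x ||| v) = maskEntropy h d c (y ||| x) := by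
  have h1 := hh.mask_submod (d := d) (c := c) y v x
  have h2 := hh.mask_mono (d := d) (c := c) (y ||| x) v
  have h3 : y ||| v ||| x = y ||| x ||| v := by
    rw [Nat.lor_assoc, Nat.lor_comm v, ← Nat.lor_assoc]
  rw [h3, Nat.lor_comm v, hxv] at h1
  linarith

theorem IsCopyExtension.mask_base (hh : IsCopyExtension H K h) (x : ℕ) (hx : copyPart c x = ∅) :
    maskEntropy h d c x = H (basePart d x) := by
  rw [maskEntropy, hx, Finset.image_empty, Finset.union_empty, hh.left]

/-- Inside the common part, copies may be replaced by the originals. -/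
theorem IsCopyExtension.mask_transfer (hh : IsCopyExtension H K h) (x t t' : ℕ)
    (hx : copyPart c x = ∅ ∧ basePart d x ⊆ K)
    (ht : basePart d t = ∅ ∧ copyPart c t' = ∅ ∧ copyPart c t = basePart d t') :
    maskEntropy h d c (x ||| t) = maskEntropy h d c (x ||| t') := by
  rw [hh.mask_base (x ||| t') (by rw [copyPart_lor, hx.1, ht.2.1, Finset.union_empty]),
    maskEntropy, basePart_lor, copyPart_lor, hx.1, ht.1, Finset.union_empty, Finset.empty_union,
    hh.transfer _ _ hx.2, ht.2.2, basePart_lor]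

/-- The copies are independent of the originals conditionally on the common part. -/
theorem IsCopyExtension.mask_indep (hh : IsCopyExtension H K h) (k x t t' : ℕ)
    (hk : copyPart c k = ∅ ∧ basePart d k = K)
    (hx : copyPart c x = ∅ ∧ K ⊆ basePart d x)
    (ht : basePart d t = ∅ ∧ copyPart c t' = ∅ ∧ copyPart c t = basePart d t') :
    maskEntropy h d c (x ||| t) + maskEntropy h d c k =
      maskEntropy h d c x + maskEntropy h d c (k ||| t') := by
  rw [hh.mask_base (k ||| t') (by rw [copyPart_lor, hk.1, ht.2.1, Finset.union_empty]),
    hh.mask_base x hx.1, hh.mask_base k hk.1,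
    maskEntropy, basePart_lor, copyPart_lor, hx.1, ht.1, Finset.union_empty, Finset.empty_union,
    hk.2, hh.indep _ _ hx.2, ht.2.2, basePart_lor, hk.2]

end Mask

/-! ### Perfectness expressed through masks -/

namespace ShareFamily.IsPerfectScheme

variable {F : ShareFamily.{u} (Fin 8)} {K : Finset (Option (Fin 8))}
  {h : Finset (Option (Fin 8) ⊕ Option (Fin 8)) → ℝ} {d : Fin 8} {c : Fin 2 → Option (Fin 8)}

/-- A set of shares that spans the dealer determines the secret. -/
theorem mask_qualified (hF : F.IsPerfectScheme (inducedAccess vamosMatroid d))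
    (hh : IsCopyExtension F.H K h) {s : ℕ}
    (hs : basePart d s = {none} ∧ copyPart c s = ∅) (x : ℕ) (I : Finset (Fin 8))
    (hx : basePart d x = I.image some ∧ copyPart c x = ∅)
    (hI : d ∉ I ∧ VamosIndep I ∧ ¬ VamosIndep (insert d I)) :
    maskEntropy h d c (x ||| s) = maskEntropy h d c x := by
  have := hF.qualified I (mem_qualified_vamos I hI.1 subset_rfl hI.2.1 hI.2.2)
  rw [hh.mask_base _ (by rw [copyPart_lor, hs.2, hx.2, Finset.union_empty]),
    hh.mask_base _ hx.2, basePart_lor, hs.1, hx.1, Finset.union_comm]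
  exact sub_eq_zero.1 this

/-- A set of shares that does not span the dealer is independent of the secret. -/
theorem mask_unqualified (hF : F.IsPerfectScheme (inducedAccess vamosMatroid d))
    (hh : IsCopyExtension F.H K h) {s : ℕ}
    (hs : basePart d s = {none} ∧ copyPart c s = ∅) (x : ℕ) (X I : Finset (Fin 8))
    (hx : basePart d x = X.image some ∧ copyPart c x = ∅)
    (hX : d ∉ X ∧ I ⊆ X ∧ VamosIndep (insert d I) ∧
      ∀ x ∈ X, x ∈ I ∨ ¬ VamosIndep (insert x I)) :
    maskEntropy h d c (x ||| s) = maskEntropy h d c x + maskEntropy h d c s := by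
  have := hF.unqualified X (notMem_qualified_vamos I hX.1 hX.2.1 hX.2.2.1 hX.2.2.2)
  rw [hh.mask_base _ (by rw [copyPart_lor, hs.2, hx.2, Finset.union_empty]),
    hh.mask_base _ hx.2, hh.mask_base _ hs.2, basePart_lor, hs.1, hx.1, Finset.union_comm]
  exact (sub_eq_iff_eq_add'.1 this)

end ShareFamily.IsPerfectScheme

/-! ### The entropy estimates for the two Vamos access structures -/

/-- Masks: 15 is `K = A ∪ B`, 16 the share of `v_5`, 32 the secret, 256 and 512 the copies of these
last two. -/
theorem V6_share_bound {F : ShareFamily.{u} (Fin 8)} (hF : F.IsPerfectScheme V6) {b : ℝ}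
    (hb : ∀ x, F.H {some x} ≤ b) : 9 / 8 * F.H {none} ≤ b := by
  obtain ⟨h, hh⟩ := F.exists_isCopyExtension_H {some 0, some 1, some 2, some 3}
  let f := maskEntropy h 5 ![some 4, none]
  have sub (x y z : ℕ) : f (x ||| y ||| z) + f z ≤ f (x ||| z) + f (y ||| z) :=
    hh.mask_submod x y z
  have mono (x y : ℕ) : f x ≤ f (x ||| y) := hh.mask_mono x y
  have hs : basePart 5 32 = {none} ∧ copyPart ![some 4, none] 32 = ∅ := by decide
  have indep1 (x : ℕ) (hx) : f (x ||| 256) + f 15 = f x + f 31 :=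
    hh.mask_indep 15 x 256 16 (by decide) hx (by decide)
  have indep2 (x : ℕ) (hx) : f (x ||| 512) + f 15 = f x + f 47 :=
    hh.mask_indep 15 x 512 32 (by decide) hx (by decide)
  have indep3 (x : ℕ) (hx) : f (x ||| 768) + f 15 = f x + f 63 :=
    hh.mask_indep 15 x 768 48 (by decide) hx (by decide)
  have trans1 (x : ℕ) (hx) : f (x ||| 256) = f (x ||| 16) :=
    hh.mask_transfer x 256 16 hx (by decide)
  have trans2 (x : ℕ) (hx) : f (x ||| 512) = f (x ||| 32) :=
    hh.mask_transfer x 512 32 hx (by decide)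
  have trans3 (x : ℕ) (hx) : f (x ||| 768) = f (x ||| 48) :=
    hh.mask_transfer x 768 48 hx (by decide)
  have rate (i : Fin 8) (hi : basePart 5 (2 ^ i.val) = {some i} ∧
      copyPart ![some 4, none] (2 ^ i.val) = ∅) :
      f (2 ^ i.val) ≤ b :=
    (hh.mask_base _ hi.2).trans_le (hi.1.symm ▸ hb i)
  have q014 : f (19 ||| 32) = f 19 :=
    hF.mask_qualified hh hs 19 {0, 1, 4} (by decide) (by decide)
  have q0126 : f (71 ||| 32) = f 71 :=
    hF.mask_qualified hh hs 71 {0, 1, 2, 6} (by decide) (by decide)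
  have q0167 : f (195 ||| 32) = f 195 :=
    hF.mask_qualified hh hs 195 {0, 1, 6, 7} (by decide) (by decide)
  have q1236 : f (78 ||| 32) = f 78 :=
    hF.mask_qualified hh hs 78 {1, 2, 3, 6} (by decide) (by decide)
  have q467 : f (208 ||| 32) = f 208 :=
    hF.mask_qualified hh hs 208 {4, 6, 7} (by decide) (by decide)
  have q0127 : f (135 ||| 32) = f 135 :=
    hF.mask_qualified hh hs 135 {0, 1, 2, 7} (by decide) (by decide)
  have q234 : f (28 ||| 32) = f 28 :=
    hF.mask_qualified hh hs 28 {2, 3, 4} (by decide) (by decide)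
  -- The pair `A` (mask 3) lies in `K`, so the relation "`A` and `v_5` determine the secret" passes
  -- to the copies; `p268` does the same for `B` (mask 12).
  have p259 : f (259 ||| 512) = f 259 :=
    (trans3 3 (by decide)).trans (q014.trans (trans1 3 (by decide)).symm)
  have p268 : f (268 ||| 512) = f 268 :=
    (trans3 12 (by decide)).trans (q234.trans (trans1 12 (by decide)).symm)
  have e899 : f 899 = f 387 := hh.mask_determined p259 128
  have e963 : f 963 = f 451 := hh.mask_determined p259 192
  have e256 : f 256 = f 16 := trans1 0 (by decide)
  -- The empty set is unqualified, so `f 32 = f 0 + f 32`.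
  have e0 : f 0 = 0 :=
    right_eq_add.1
      (hF.mask_unqualified hh hs 0 ∅ ∅ (by decide) (by decide))
  have e236 : f 236 = f 204 + f 32 :=
    hF.mask_unqualified hh hs 204 {2, 3, 6, 7} {2, 3, 6} (by decide) (by decide)
  have e483 : f 483 = f 451 := hh.mask_determined q0167 256
  have e238 : f 238 = f 206 := hh.mask_determined q1236 128
  have e495 : f 495 + f 15 = f 239 + f 31 := indep1 239 (by decide)
  have e226 : f 226 = f 194 + f 32 :=
    hF.mask_unqualified hh hs 194 {1, 6, 7} {1, 6, 7} (by decide) (by decide)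
  have e240 : f 240 = f 208 := hh.mask_determined q467 0
  have e112 : f 112 = f 80 + f 32 :=
    hF.mask_unqualified hh hs 80 {4, 6} {4, 6} (by decide) (by decide)
  have e831 : f 831 + f 15 = f 63 + f 63 := indep3 63 (by decide)
  have e559 : f 559 + f 15 = f 47 + f 47 := indep2 47 (by decide)
  have e835 : f 835 = f 323 := hh.mask_determined p259 64
  have e175 : f 175 = f 143 := hh.mask_determined q0127 8
  have e163 : f 163 = f 131 + f 32 :=
    hF.mask_unqualified hh hs 131 {0, 1, 7} {0, 1, 7} (by decide) (by decide)
  have e99 : f 99 = f 67 + f 32 :=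
    hF.mask_unqualified hh hs 67 {0, 1, 6} {0, 1, 6} (by decide) (by decide)
  have e258 : f 258 = f 18 := trans1 2 (by decide)
  have e764 : f 764 = f 732 := hh.mask_determined q234 704
  have e767 : f 767 + f 15 = f 255 + f 47 := indep2 255 (by decide)
  have e1023 : f 1023 + f 15 = f 255 + f 63 := indep3 255 (by decide)
  have e1007 : f 1007 + f 15 = f 239 + f 63 := indep3 239 (by decide)
  have e271 : f 271 = f 31 := trans1 15 (by decide)
  have e399 : f 399 + f 15 = f 143 + f 31 := indep1 143 (by decide)
  have e263 : f 263 = f 23 := trans1 7 (by decide)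
  have e1008 : f 1008 = f 976 := hh.mask_determined q467 768
  have e48 : f 48 = f 16 + f 32 := hF.mask_unqualified hh hs 16 {4} {4} (by decide) (by decide)
  have e110 : f 110 = f 78 := hh.mask_determined q1236 0
  have e63 : f 63 = f 31 := hh.mask_determined q014 12
  have e46 : f 46 = f 14 + f 32 :=
    hF.mask_unqualified hh hs 14 {1, 2, 3} {1, 2, 3} (by decide) (by decide)
  have e775 : f 775 = f 55 := trans3 7 (by decide)
  have e903 : f 903 = f 391 := hh.mask_determined p259 132
  have e770 : f 770 = f 50 := trans3 2 (by decide)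
  have e771 : f 771 = f 51 := trans3 3 (by decide)
  have e787 : f 787 = f 275 := hh.mask_determined p259 16
  have e828 : f 828 = f 796 := hh.mask_determined q234 768
  have e819 : f 819 = f 787 := hh.mask_determined q014 768
  have e514 : f 514 = f 34 := trans2 2 (by decide)
  have e768 : f 768 = f 48 := trans3 0 (by decide)
  have e972 : f 972 = f 460 := hh.mask_determined p268 192
  have e47 : f 47 = f 15 + f 32 :=
    hF.mask_unqualified hh hs 15 {0, 1, 2, 3} {0, 1, 2} (by decide) (by decide)
  have e255 : f 255 = f 223 := hh.mask_determined q014 204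
  have e55 : f 55 = f 23 := hh.mask_determined q014 4
  have e50 : f 50 = f 18 + f 32 :=
    hF.mask_unqualified hh hs 18 {1, 4} {1, 4} (by decide) (by decide)
  have e51 : f 51 = f 19 := hh.mask_determined q014 0
  have e796 : f 796 = f 284 := hh.mask_determined p268 16
  have e34 : f 34 = f 2 + f 32 := hF.mask_unqualified hh hs 2 {1} {1} (by decide) (by decide)
  have i0 : f 963 + f 898 ≤ f 899 + f 962 := sub 1 64 898
  have i1 : f 786 + f 0 ≤ f 530 + f 256 := sub 530 256 0
  have i2 : f 19 + f 0 ≤ f 17 + f 2 := sub 17 2 0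
  have i3 : f 236 ≤ f 239 := mono 236 3
  have i4 : f 8 ≤ b := rate 3 (by decide)
  have i5 : f 495 + f 226 ≤ f 483 + f 238 := sub 257 12 226
  have i6 : f 752 + f 112 ≤ f 240 + f 624 := sub 128 512 112
  have i7 : f 559 ≤ f 831 := mono 559 272
  have i8 : f 963 + f 832 ≤ f 960 + f 835 := sub 128 3 832
  have i9 : f 495 + f 163 ≤ f 483 + f 175 := sub 320 12 163
  have i10 : f 4 ≤ b := rate 2 (by decide)
  have i11 : f 99 ≤ f 127 := mono 99 28
  have i12 : f 274 + f 0 ≤ f 258 + f 16 := sub 258 16 0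
  have i13 : f 208 + f 0 ≤ f 192 + f 16 := sub 192 16 0
  have i14 : f 206 + f 12 ≤ f 204 + f 14 := sub 192 2 12
  have i15 : f 128 ≤ b := rate 7 (by decide)
  have i16 : f 16 ≤ b := rate 4 (by decide)
  have i17 : f 323 + f 0 ≤ f 256 + f 67 := sub 256 67 0
  have i18 : f 767 + f 236 ≤ f 764 + f 239 := sub 528 3 236
  have i19 : f 1007 ≤ f 1023 := mono 1007 16
  have i20 : f 387 + f 0 ≤ f 256 + f 131 := sub 256 131 0
  have i21 : f 399 + f 263 ≤ f 271 + f 391 := sub 8 128 263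
  have i22 : f 732 ≤ f 988 := mono 732 256
  have i23 : f 1 ≤ b := rate 0 (by decide)
  have i24 : f 1008 + f 48 ≤ f 816 + f 240 := sub 768 192 48
  have i25 : f 284 + f 0 ≤ f 276 + f 8 := sub 276 8 0
  have i26 : f 17 + f 0 ≤ f 1 + f 16 := sub 1 16 0
  have i27 : f 78 ≤ f 223 := mono 78 145
  have i28 : f 962 + f 192 ≤ f 960 + f 194 := sub 768 2 192
  have i29 : f 272 + f 0 ≤ f 16 + f 256 := sub 16 256 0
  have i30 : f 2 ≤ b := rate 1 (by decide)
  have i31 : f 127 + f 46 ≤ f 110 + f 63 := sub 64 17 46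
  have i32 : f 903 + f 770 ≤ f 898 + f 775 := sub 128 5 770
  have i33 : f 460 + f 0 ≤ f 256 + f 204 := sub 256 204 0
  have i34 : f 284 + f 0 ≤ f 272 + f 12 := sub 272 12 0
  have i35 : f 787 + f 770 ≤ f 771 + f 786 := sub 1 16 770
  have i36 : f 831 + f 816 ≤ f 828 + f 819 := sub 12 3 816
  have i37 : f 275 + f 0 ≤ f 274 + f 1 := sub 274 1 0
  have i38 : f 530 + f 0 ≤ f 514 + f 16 := sub 514 16 0
  have i39 : f 880 + f 768 ≤ f 832 + f 816 := sub 64 48 768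
  have i40 : f 988 + f 960 ≤ f 976 + f 972 := sub 16 12 960
  have i41 : f 1008 + f 624 ≤ f 752 + f 880 := sub 128 256 624
  have i42 : f 208 + f 0 ≤ f 128 + f 80 := sub 128 80 0
  have i43 : f 276 + f 0 ≤ f 272 + f 4 := sub 272 4 0
  have secret : f 32 = F.H {none} := (hh.mask_base _ hs.2).trans (congrArg F.H hs.1)
  rw [← secret]
  clear_value f
  -- A dual solution of the linear program. The inequalities have nonnegative weights, and those of
  -- the share bounds sum to 1, with 5/8 on the dealer's partner `v_5`.
  linear_combination
    1/16 * i0 + 1/32 * i1 + 1/32 * i2 + 1/16 * i3 + 1/16 * i4 + 1/16 * i5 + 1/16 * i6 + 5/32 *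
    i7 + 1/16 * i8 + 1/16 * i9 + 1/16 * i10 + 1/16 * i11 + 3/32 * i12 + 1/16 * i13 + 1/16 *
    i14 + 1/16 * i15 + 5/8 * i16 + 1/16 * i17 + 1/8 * i18 + 1/16 * i19 + 1/16 * i20 + 1/16 *
    i21 + 1/8 * i22 + 1/8 * i23 + 1/16 * i24 + 1/16 * i25 + 1/32 * i26 + 1/16 * i27 + 1/16 *
    i28 + 1/8 * i29 + 1/16 * i30 + 1/16 * i31 + 1/16 * i32 + 1/8 * i33 + 1/16 * i34 + 1/32 *
    i35 + 1/8 * i36 + 3/32 * i37 + 1/32 * i38 + 1/16 * i39 + 1/8 * i40 + 1/16 * i41 + 1/16 *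
    i42 + 1/16 * i43 + 1/16 * e899 - 1/8 * e963 + 13/32 * e256 - 1 * e0 - 3/16 * e236 + 1/8 *
    e483 + 1/16 * e238 - 1/8 * e495 - 1/16 * e226 + 1/8 * e240 - 1/16 * e112 + 1/32 * e831 -
    5/32 * e559 + 1/16 * e835 + 1/16 * e175 - 1/16 * e163 - 1/16 * e99 + 3/32 * e258 + 1/8 *
    e764 - 1/8 * e767 + 1/16 * e1023 - 1/16 * e1007 + 1/16 * e271 - 1/16 * e399 - 1/16 * e263
    - 1/8 * e1008 - 1/8 * e48 + 1/16 * e110 + 1/8 * e63 - 1/16 * e46 + 1/16 * e775 - 1/16 *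
    e903 - 3/32 * e770 + 1/32 * e771 + 3/32 * e787 + 1/8 * e828 + 1/8 * e819 + 1/32 * e514 -
    1/16 * e768 + 1/8 * e972 - 7/16 * e47 - 1/16 * e255 + 1/16 * e55 - 3/32 * e50 + 1/32 * e51
    + 1/8 * e796 + 1/32 * e34

/-- The same scheme of proof with 60 for `K = B ∪ C`, 1 for the secret, 2 for the share of `v_2`,
and 256 and 512 for the copies of these last two. -/
theorem V1_share_bound {F : ShareFamily.{u} (Fin 8)} (hF : F.IsPerfectScheme V1) {b : ℝ}
    (hb : ∀ x, F.H {some x} ≤ b) : 9 / 8 * F.H {none} ≤ b := by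
  obtain ⟨h, hh⟩ := F.exists_isCopyExtension_H {some 2, some 3, some 4, some 5}
  let f := maskEntropy h 0 ![none, some 1]
  have sub (x y z : ℕ) : f (x ||| y ||| z) + f z ≤ f (x ||| z) + f (y ||| z) :=
    hh.mask_submod x y z
  have mono (x y : ℕ) : f x ≤ f (x ||| y) := hh.mask_mono x y
  have hs : basePart 0 1 = {none} ∧ copyPart ![none, some 1] 1 = ∅ := by decide
  have indep1 (x : ℕ) (hx) : f (x ||| 256) + f 60 = f x + f 61 :=
    hh.mask_indep 60 x 256 1 (by decide) hx (by decide)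
  have indep2 (x : ℕ) (hx) : f (x ||| 512) + f 60 = f x + f 62 :=
    hh.mask_indep 60 x 512 2 (by decide) hx (by decide)
  have indep3 (x : ℕ) (hx) : f (x ||| 768) + f 60 = f x + f 63 :=
    hh.mask_indep 60 x 768 3 (by decide) hx (by decide)
  have trans2 (x : ℕ) (hx) : f (x ||| 512) = f (x ||| 2) :=
    hh.mask_transfer x 512 2 hx (by decide)
  have trans3 (x : ℕ) (hx) : f (x ||| 768) = f (x ||| 3) :=
    hh.mask_transfer x 768 3 hx (by decide)
  have rate (i : Fin 8) (hi : basePart 0 (2 ^ i.val) = {some i} ∧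
      copyPart ![none, some 1] (2 ^ i.val) = ∅) :
      f (2 ^ i.val) ≤ b :=
    (hh.mask_base _ hi.2).trans_le (hi.1.symm ▸ hb i)
  have q123 : f (14 ||| 1) = f 14 :=
    hF.mask_qualified hh hs 14 {1, 2, 3} (by decide) (by decide)
  have q1246 : f (86 ||| 1) = f 86 :=
    hF.mask_qualified hh hs 86 {1, 2, 4, 6} (by decide) (by decide)
  have q145 : f (50 ||| 1) = f 50 :=
    hF.mask_qualified hh hs 50 {1, 4, 5} (by decide) (by decide)
  have q2347 : f (156 ||| 1) = f 156 :=
    hF.mask_qualified hh hs 156 {2, 3, 4, 7} (by decide) (by decide)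
  have q3456 : f (120 ||| 1) = f 120 :=
    hF.mask_qualified hh hs 120 {3, 4, 5, 6} (by decide) (by decide)
  have q1247 : f (150 ||| 1) = f 150 :=
    hF.mask_qualified hh hs 150 {1, 2, 4, 7} (by decide) (by decide)
  have q1267 : f (198 ||| 1) = f 198 :=
    hF.mask_qualified hh hs 198 {1, 2, 6, 7} (by decide) (by decide)
  have p560 : f (560 ||| 256) = f 560 :=
    (trans3 48 (by decide)).trans (q145.trans (trans2 48 (by decide)).symm)
  have p524 : f (524 ||| 256) = f 524 :=
    (trans3 12 (by decide)).trans (q123.trans (trans2 12 (by decide)).symm)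
  have e205 : f 205 = f 204 + f 1 :=
    hF.mask_unqualified hh hs 204 {2, 3, 6, 7} {2, 3, 6} (by decide) (by decide)
  have e983 : f 983 = f 982 := hh.mask_determined q1246 896
  have e195 : f 195 = f 194 + f 1 :=
    hF.mask_unqualified hh hs 194 {1, 6, 7} {1, 6, 7} (by decide) (by decide)
  have e816 : f 816 = f 51 := trans3 48 (by decide)
  have e800 : f 800 = f 35 := trans3 32 (by decide)
  have e189 : f 189 = f 188 := hh.mask_determined q2347 32
  have e191 : f 191 = f 190 := hh.mask_determined q123 176
  have e61 : f 61 = f 60 + f 1 :=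
    hF.mask_unqualified hh hs 60 {2, 3, 4, 5} {2, 3, 4} (by decide) (by decide)
  have e512 : f 512 = f 2 := trans2 0 (by decide)
  have e0 : f 0 = 0 :=
    right_eq_add.1
      (hF.mask_unqualified hh hs 0 ∅ ∅ (by decide) (by decide))
  have e894 : f 894 + f 60 = f 126 + f 63 := indep3 126 (by decide)
  have e958 : f 958 + f 60 = f 190 + f 63 := indep3 190 (by decide)
  have e444 : f 444 + f 60 = f 188 + f 61 := indep1 188 (by decide)
  have e516 : f 516 = f 6 := trans2 4 (by decide)
  have e9 : f 9 = f 8 + f 1 := hF.mask_unqualified hh hs 8 {3} {3} (by decide) (by decide)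
  have e343 : f 343 = f 342 := hh.mask_determined q1246 256
  have e383 : f 383 + f 60 = f 127 + f 61 := indep1 127 (by decide)
  have e23 : f 23 = f 22 + f 1 :=
    hF.mask_unqualified hh hs 22 {1, 2, 4} {1, 2, 4} (by decide) (by decide)
  have e783 : f 783 = f 782 := hh.mask_determined q123 768
  have e831 : f 831 + f 60 = f 63 + f 63 := indep3 63 (by decide)
  have e1008 : f 1008 = f 752 := hh.mask_determined p560 192
  have e972 : f 972 = f 716 := hh.mask_determined p524 192
  have e1020 : f 1020 + f 60 = f 252 + f 63 := indep3 252 (by decide)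
  have e819 : f 819 = f 818 := hh.mask_determined q145 768
  have e780 : f 780 = f 15 := trans3 12 (by decide)
  have e503 : f 503 = f 502 := hh.mask_determined q145 452
  have e249 : f 249 = f 248 := hh.mask_determined q3456 128
  have e511 : f 511 + f 60 = f 255 + f 61 := indep1 255 (by decide)
  have e241 : f 241 = f 240 + f 1 :=
    hF.mask_unqualified hh hs 240 {4, 5, 6, 7} {4, 5, 6} (by decide) (by decide)
  have e151 : f 151 = f 150 := hh.mask_determined q1247 0
  have e199 : f 199 = f 198 := hh.mask_determined q1267 0
  have e135 : f 135 = f 134 + f 1 :=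
    hF.mask_unqualified hh hs 134 {1, 2, 7} {1, 2, 7} (by decide) (by decide)
  have e572 : f 572 = f 62 := trans2 60 (by decide)
  have e573 : f 573 + f 60 = f 61 + f 62 := indep2 61 (by decide)
  have e524 : f 524 = f 14 := trans2 12 (by decide)
  have e51 : f 51 = f 50 := hh.mask_determined q145 0
  have e35 : f 35 = f 34 + f 1 := hF.mask_unqualified hh hs 34 {1, 5} {1, 5} (by decide) (by decide)
  have e127 : f 127 = f 126 := hh.mask_determined q123 112
  have e15 : f 15 = f 14 := hh.mask_determined q123 0
  have i0 : f 470 ≤ f 982 := mono 470 512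
  have i1 : f 205 ≤ f 255 := mono 205 50
  have i2 : f 983 + f 195 ≤ f 963 + f 215 := sub 768 20 195
  have i3 : f 150 + f 6 ≤ f 22 + f 134 := sub 16 128 6
  have i4 : f 818 + f 800 ≤ f 802 + f 816 := sub 2 16 800
  have i5 : f 502 + f 342 ≤ f 374 + f 470 := sub 32 128 342
  have i6 : f 191 + f 61 ≤ f 63 + f 189 := sub 2 128 61
  have i7 : f 963 + f 768 ≤ f 960 + f 771 := sub 192 3 768
  have i8 : f 592 + f 0 ≤ f 512 + f 80 := sub 512 80 0
  have i9 : f 752 + f 80 ≤ f 592 + f 240 := sub 512 160 80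
  have i10 : f 716 + f 136 ≤ f 648 + f 204 := sub 512 68 136
  have i11 : f 374 ≤ f 894 := mono 374 520
  have i12 : f 444 ≤ f 958 := mono 444 514
  have i13 : f 525 + f 0 ≤ f 516 + f 9 := sub 516 9 0
  have i14 : f 383 + f 23 ≤ f 343 + f 63 := sub 320 40 23
  have i15 : f 2 ≤ b := rate 1 (by decide)
  have i16 : f 8 ≤ b := rate 3 (by decide)
  have i17 : f 4 ≤ b := rate 2 (by decide)
  have i18 : f 248 ≤ f 252 := mono 248 4
  have i19 : f 16 ≤ b := rate 4 (by decide)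
  have i20 : f 770 + f 0 ≤ f 768 + f 2 := sub 768 2 0
  have i21 : f 831 + f 775 ≤ f 823 + f 783 := sub 48 8 775
  have i22 : f 1020 + f 960 ≤ f 1008 + f 972 := sub 48 12 960
  have i23 : f 802 + f 0 ≤ f 770 + f 32 := sub 770 32 0
  have i24 : f 32 ≤ b := rate 5 (by decide)
  have i25 : f 648 + f 0 ≤ f 512 + f 136 := sub 512 136 0
  have i26 : f 823 + f 771 ≤ f 819 + f 775 := sub 48 4 771
  have i27 : f 198 + f 0 ≤ f 194 + f 4 := sub 194 4 0
  have i28 : f 782 + f 768 ≤ f 780 + f 770 := sub 12 2 768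
  have i29 : f 511 + f 241 ≤ f 503 + f 249 := sub 262 8 241
  have i30 : f 215 + f 135 ≤ f 151 + f 199 := sub 16 64 135
  have i31 : f 50 + f 0 ≤ f 34 + f 16 := sub 34 16 0
  have i32 : f 573 + f 524 ≤ f 572 + f 525 := sub 48 1 524
  have secret : f 1 = F.H {none} := (hh.mask_base _ hs.2).trans (congrArg F.H hs.1)
  rw [← secret]
  clear_value f
  -- Again the weights of the share bounds sum to 1, now with 1/2 on the dealer's partner `v_2`.
  linear_combination
    1/8 * i0 + 1/8 * i1 + 1/8 * i2 + 1/8 * i3 + 1/8 * i4 + 1/8 * i5 + 1/16 * i6 + 1/8 * i7 +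
    1/8 * i8 + 1/8 * i9 + 1/8 * i10 + 1/8 * i11 + 1/16 * i12 + 1/8 * i13 + 1/8 * i14 + 1/2 *
    i15 + 1/8 * i16 + 1/8 * i17 + 1/8 * i18 + 1/8 * i19 + 1/4 * i20 + 1/8 * i21 + 1/8 * i22 +
    1/8 * i23 + 1/8 * i24 + 1/8 * i25 + 1/8 * i26 + 1/8 * i27 + 1/8 * i28 + 1/8 * i29 + 1/8 *
    i30 + 1/8 * i31 + 1/8 * i32 - 1/8 * e205 - 1/8 * e983 - 1/8 * e195 + 1/8 * e816 - 1/8 *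
    e800 + 1/16 * e189 - 1/16 * e191 - 1/2 * e61 + 1/4 * e512 - 1 * e0 + 1/8 * e894 + 1/16 *
    e958 - 1/16 * e444 + 1/8 * e516 + 1/8 * e9 + 1/8 * e343 - 1/8 * e383 - 1/8 * e23 + 1/8 *
    e783 - 1/8 * e831 + 1/8 * e1008 + 1/8 * e972 - 1/8 * e1020 + 1/8 * e819 + 1/8 * e780 + 1/8
    * e503 + 1/8 * e249 - 1/8 * e511 - 1/8 * e241 + 1/8 * e151 + 1/8 * e199 - 1/8 * e135 + 1/8
    * e572 - 1/8 * e573 - 1/8 * e524 + 1/8 * e51 - 1/8 * e35 - 1/8 * e127 + 1/8 * e15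

/-! ### Bounds on the information rate -/

/-- The participant with the largest share entropy bounds the minimum of the rates. Positivity of
that entropy, needed for the division, comes from `H(S) > 0`. -/
theorem informationRate_le {P : Type*} [DecidableEq P] [Fintype P] [Nonempty P]
    {Γ : AccessStructure P} {r : ℝ≥0∞} {ρ : ℝ} (hρ : 0 < ρ) (hr : ENNReal.ofReal ρ ≤ r)
    (h : ∀ F : ShareFamily.{u} P, F.IsPerfectScheme Γ → ∀ b : ℝ,
      (∀ x, F.H {some x} ≤ b) → F.H {none} ≤ ρ * b) :
    informationRate.{u} Γ ≤ r := by
  refine iSup₂_le fun F hF => (ENNReal.ofReal_le_ofReal ?_).trans hr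
  obtain ⟨x, -, hx⟩ := Finset.exists_max_image Finset.univ (fun x => F.H {some x})
    Finset.univ_nonempty
  have hb := h F hF _ fun y => hx y (Finset.mem_univ y)
  have hpos : 0 < F.H {some x} := pos_of_mul_pos_right (hF.secret_pos.trans_le hb) hρ.le
  refine (Finset.inf'_le _ (Finset.mem_univ x)).trans ?_
  rw [ShareFamily.participantRate, div_le_iff₀ hpos]
  exact hb

end SecretSharing

theorem mainTheorem3 :
    SecretSharing.informationRate.{u} SecretSharing.V6 ≤ 17 / 19 ∧
      SecretSharing.informationRate.{u} SecretSharing.V1 ≤ 19 / 21 := by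
  constructor
  -- `8/9` is the reciprocal of `9/8`. It is below `17/19` as `152 < 153`, and below `19/21` as `168
  -- < 171`.
  · refine SecretSharing.informationRate_le (ρ := 8 / 9) (by norm_num) ?_ fun F hF b hb => ?_
    · rw [ENNReal.ofReal_le_iff_le_toReal (by finiteness)]
      norm_num
    · linarith [SecretSharing.V6_share_bound hF hb]
  · refine SecretSharing.informationRate_le (ρ := 8 / 9) (by norm_num) ?_ fun F hF b hb => ?_
    · rw [ENNReal.ofReal_le_iff_le_toReal (by finiteness)]
      norm_num
    · linarith [SecretSharing.V1_share_bound hF hb]
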